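/- For a sequence $a$ put $T_5(n)=a(n)+a(n-1)+a(n-2)+a(n-3)+a(n-4)$. The almost Golomb sequence of order $5$ is the earliest (lexicographically least) nondecreasing sequence of positive integers $(a(n))_{n\ge1}$, extended by $a(k)=0$ for $k\le 0$, such that $a(T_5(n))=n$ for all $n\ge1$. A sequence $(f(n))_{n\ge0}$ with finitely many values is $5$-automatic if its $5$-kernel $\{(f(5^in+j))_{n\ge0}: i\ge0,\ 0\le j<5^i\}$ is finite; an integer sequence is $5$-regular if the $\mathbb Z$-module spanned by its $5$-kernel is finitely generated. **Theorem.** The almost Golomb sequence $a$ of order $5$ exists and is unique. For all integers $n$ define $$\varepsilon(n)=a(5n)-T_5(n)-2,\qquad \eta(n)=T_5(n+2)-1-a(5n+2),$$ $$\theta(n)=a(5n+3)-T_5(n+3)+4,\qquad \varepsilon_4(n)=a(5n+4)-T_5(n+4)+2,$$ and $U(n)=(\varepsilon(n),\eta(n))$, $\sigma(n)=\varepsilon(n)+\eta(n)$. Then: 1. For all $n\ge3$, $$\begin{aligned}a(5n)&=T_5(n)+2+\varepsilon(n),\\ a(5n+1)&=T_5(n+1)+1-\varepsilon(n),\\ a(5n+2)&=T_5(n+2)-1-\eta(n),\\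 a(5n+3)&=T_5(n+3)-4+\theta(n),\\ a(5n+4)&=T_5(n+4)-2+\varepsilon_4(n).\end{aligned}$$ 2. For all $n\ge1$: $\varepsilon(n),\eta(n)\in\{0,1\}$ and $\varepsilon(n)\eta(n)=0$. On $\{n\ge 1\}$ the pair $(\varepsilon,\eta)$ is the unique pair of sequences with the following properties. For $1\le n\le19$, $\varepsilon(n)=1$ if $n\in\{4,13,15,17,19\}$ and $\varepsilon(n)=0$ otherwise, while $\eta(n)=1$ if $n\in\{3,12,14,16,18\}$ and $\eta(n)=0$ otherwise. For all $m\ge4$, $$\varepsilon(5m)=\varepsilon(m-1)(1-\varepsilon(m)),\quad \varepsilon(5m+1)=\varepsilon(5m+3)=\varepsilon(m),\quad \varepsilon(5m+2)=\varepsilon(5m+4)=\eta(m),$$ $$\eta(5m)=\eta(5m+2)=\eta(5m+4)=\varepsilon(m),\quad \eta(5m+1)=\eta(5m+3)=\eta(m).$$ 3. The pairs $(U(m-1),U(m))$ that occur for $m\ge3$ are exactly $((0,0),(0,0))$, $((0,0),(0,1))$, $((0,1),(1,0))$, $((1,0),(0,0))$, $((1,0),(0,1))$. 4. For all $n\ge3$: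 $\theta(n)\in\{0,1\}$ and $\varepsilon_4(n)\in\{-4,-3,-2\}$. For $3\le n\le14$: $\theta(n)=0$ if $n\in\{11,13\}$ and $\theta(n)=1$ otherwise; $\varepsilon_4(n)=-4$ if $n\in\{12,14\}$, $\varepsilon_4(n)=-3$ if $n\in\{3,10,11,13\}$, and $\varepsilon_4(n)=-2$ otherwise. For all $m\ge3$, the values $(\theta(5m+d))_{d=0,\dots,4}$ are $(1,1,1,1,1)$ if $U(m)=(0,0)$, $(0,1,0,1,0)$ if $U(m)=(0,1)$, and $(1,0,1,0,1)$ if $U(m)=(1,0)$. Also for all $m\ge3$, $$\varepsilon_4(5m+d)=-2-\sigma(m)-\varepsilon(m)\ \ (d\in\{0,2\}),\qquad \varepsilon_4(5m+d)=-2-\sigma(m)-\eta(m)\ \ (d\in\{1,3\}),$$ and $\varepsilon_4(5m+4)$ equals $-2$ if $(U(m),U(m+1))=((0,0),(0,0))$; $-3$ if $(U(m),U(m+1))\in\{((0,0),(0,1)),((0,1),(1,0)),((1,0),(0,0))\}$; and $-4$ if $(U(m),U(m+1))=((1,0),(0,1))$. 5. The sequences $(U(n))_{n\ge0}$, $(\theta(n))_{n\ge0}$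 and $(\varepsilon_4(n))_{n\ge0}$ are $5$-automatic, and $(a(n))_{n\ge0}$ is $5$-regular. -/

import Mathlib

namespace AlmostGolomb

/-- The sliding-window sum `T_r(n) = a(n) + a(n-1) + ⋯ + a(n-r+1)`. -/
def windowSum (r : ℕ) (a : ℤ → ℤ) (n : ℤ) : ℤ :=
  ∑ j ∈ Finset.range r, a (n - (j : ℤ))

/-- A nondecreasing sequence of positive integers `(a(n))_{n ≥ 1}`, extended by `a(k) = 0` for
`k ≤ 0`, with `a(a(n) + a(n-1) + ⋯ + a(n-r+1)) = n` for every `n ≥ 1`. -/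
structure IsWindowSolution (r : ℕ) (a : ℤ → ℤ) : Prop where
  eq_zero : ∀ k : ℤ, k ≤ 0 → a k = 0
  pos : ∀ n : ℤ, 1 ≤ n → 0 < a n
  mono : ∀ m n : ℤ, 1 ≤ m → m ≤ n → a m ≤ a n
  nested : ∀ n : ℤ, 1 ≤ n → a (windowSum r a n) = n

/-- The almost Golomb sequence of order `r`: the earliest (lexicographically least) solution,
i.e. each `a(n)` is the smallest value that a solution with the same preceding terms can take. -/
structure IsAlmostGolomb (r : ℕ) (a : ℤ → ℤ) : Prop extends IsWindowSolution r a where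
  minimal : ∀ b : ℤ → ℤ, IsWindowSolution r b → ∀ n : ℤ, 1 ≤ n →
    (∀ k : ℤ, k < n → b k = a k) → a n ≤ b n

/-- The `r`-kernel `{(f(r^i n + j))_{n ≥ 0} : i ≥ 0, 0 ≤ j < r^i}`. -/
def kernelSet {α : Type*} (r : ℕ) (f : ℕ → α) : Set (ℕ → α) :=
  {g | ∃ i j : ℕ, j < r ^ i ∧ g = fun n => f (r ^ i * n + j)}

/-- `r`-automatic: finitely many values and finite `r`-kernel. -/
def IsAutomatic {α : Type*} (r : ℕ) (f : ℕ → α) : Prop :=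
  (Set.range f).Finite ∧ (kernelSet r f).Finite

/-- `r`-regular: the `ℤ`-module spanned by the `r`-kernel is finitely generated. -/
def IsRegular (r : ℕ) (f : ℕ → ℤ) : Prop :=
  (Submodule.span ℤ (kernelSet r f)).FG

/-- `ε(n) = a(5n) - T_5(n) - 2`. -/
def eps (a : ℤ → ℤ) (n : ℤ) : ℤ := a (5 * n) - windowSum 5 a n - 2

/-- `η(n) = T_5(n+2) - 1 - a(5n+2)`. -/
def eta (a : ℤ → ℤ) (n : ℤ) : ℤ := windowSum 5 a (n + 2) - 1 - a (5 * n + 2)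

/-- The pair `U(n) = (ε(n), η(n))`. -/
def pairU (a : ℤ → ℤ) (n : ℤ) : ℤ × ℤ := (eps a n, eta a n)

/-- `θ(n) = a(5n+3) - T_5(n+3) + 4`. -/
def theta (a : ℤ → ℤ) (n : ℤ) : ℤ := a (5 * n + 3) - windowSum 5 a (n + 3) + 4

/-- `ε_4(n) = a(5n+4) - T_5(n+4) + 2`. -/
def epsFour (a : ℤ → ℤ) (n : ℤ) : ℤ := a (5 * n + 4) - windowSum 5 a (n + 4) + 2

/-- The initial values (`1 ≤ n ≤ 19`) and the 5-adic recurrences (`m ≥ 4`) for `(ε, η)`. -/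
structure IsQuinaryPair (e h : ℤ → ℤ) : Prop where
  e_init : ∀ n : ℤ, 1 ≤ n → n ≤ 19 →
    e n = if n ∈ ({4, 13, 15, 17, 19} : Finset ℤ) then 1 else 0
  h_init : ∀ n : ℤ, 1 ≤ n → n ≤ 19 →
    h n = if n ∈ ({3, 12, 14, 16, 18} : Finset ℤ) then 1 else 0
  e_zero : ∀ m : ℤ, 4 ≤ m → e (5 * m) = e (m - 1) * (1 - e m)
  e_one : ∀ m : ℤ, 4 ≤ m → e (5 * m + 1) = e m
  e_two : ∀ m : ℤ, 4 ≤ m → e (5 * m + 2) = h m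
  e_three : ∀ m : ℤ, 4 ≤ m → e (5 * m + 3) = e m
  e_four : ∀ m : ℤ, 4 ≤ m → e (5 * m + 4) = h m
  h_zero : ∀ m : ℤ, 4 ≤ m → h (5 * m) = e m
  h_one : ∀ m : ℤ, 4 ≤ m → h (5 * m + 1) = h m
  h_two : ∀ m : ℤ, 4 ≤ m → h (5 * m + 2) = e m
  h_three : ∀ m : ℤ, 4 ≤ m → h (5 * m + 3) = h m
  h_four : ∀ m : ℤ, 4 ≤ m → h (5 * m + 4) = e m

/-- The transitions `(U(m-1), U(m))` listed for `m ≥ 3`. -/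
def transitions : Set ((ℤ × ℤ) × (ℤ × ℤ)) :=
  {((0, 0), (0, 0)), ((0, 0), (0, 1)), ((0, 1), (1, 0)), ((1, 0), (0, 0)), ((1, 0), (0, 1))}

/-- The rows of the table for `θ`, with `p = (U(m-1), U(m))` and columns `d = 0, …, 4`.
Pairs `p` that are not among the listed transitions get the dummy row `0`. -/
def thetaTable (p : (ℤ × ℤ) × (ℤ × ℤ)) : Fin 5 → ℤ :=
  if p = ((0, 0), (0, 0)) then ![1, 1, 1, 1, 1]
  else if p = ((1, 0), (0, 0)) then ![1, 1, 1, 1, 1]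
  else if p = ((0, 0), (0, 1)) then ![0, 1, 0, 1, 0]
  else if p = ((1, 0), (0, 1)) then ![0, 1, 0, 1, 0]
  else if p = ((0, 1), (1, 0)) then ![1, 0, 1, 0, 1]
  else 0

/-- The entry of the table for `ε_4(5m+4)`, with `p = (U(m), U(m+1))`.
Pairs `p` that are not among the listed transitions get the dummy value `0`. -/
def epsFourTable (p : (ℤ × ℤ) × (ℤ × ℤ)) : ℤ :=
  if p = ((0, 0), (0, 0)) then -2
  else if p = ((0, 0), (0, 1)) ∨ p = ((0, 1), (1, 0)) ∨ p = ((1, 0), (0, 0)) then -3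
  else if p = ((1, 0), (0, 1)) then -4
  else 0

/-- `σ(n) = ε(n) + η(n)`. -/
def sigma (a : ℤ → ℤ) (n : ℤ) : ℤ := eps a n + eta a n

end AlmostGolomb

/-! ### The greedy sequence: existence, minimality and uniqueness -/

namespace AlmostGolomb

/-! Write `T` for the window sum of order 5. The greedy sequence steps up exactly when the next
value of `T` is reached. It satisfies `T (a k) ≤ k < T (a k + 1)` for `k ≥ 3`, so it takes the value
`n ≥ 2` exactly on the block `[T n, T (n+1))` (`windowSum_bracket_aux`, `eq_of_windowSum`). It is
therefore a solution, and it is least because `T (a n)` depends only on terms before `n` when `n ≥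
3`. Lexicographic minimality forces uniqueness, so every claim may be checked on this sequence.

All the correctors are encoded in one sequence, `jump n = T (n+1) - T n - 2`, the excess of the
block length over 2: in the relevant ranges `ε n = jump n`, `η n = jump (n+1)`, `θ n = 1 - jump
(n+2)`, and `ε₄ n` is `-2` minus the three jumps at `n+1`, `n+2`, `n+3`. If the jumps near `n` are 0
or 1 with no two adjacent ones, the values of `a` near `T n` are known, hence so are the window sums
there. Inverting `T` once more yields `a (5n+d)` for `0 ≤ d ≤ 4` (`denests_of_jump`).

Since `jump k = a (k+1) - a (k-4) - 2` compares indices congruent mod 5, these formulas give `jump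
(5m+d) = jump (m+r)` with `r = -1, 0, 1, 0, 1`. Adjacent indices descend to adjacent indices, so the
binary, no-two-adjacent-ones property propagates (`jump_binary_aux`). The tables are then finite
checks. Automaticity holds because iterated descent keeps the shifts bounded, and regularity follows
likewise from `a (5m+d) = T (m+r) + c`. -/

theorem windowSum_five (a : ℤ → ℤ) (n : ℤ) :
    windowSum 5 a n = a n + a (n - 1) + a (n - 2) + a (n - 3) + a (n - 4) := by
  simp [windowSum, Finset.sum_range_succ]

theorem windowSum_succ (a : ℤ → ℤ) (n : ℤ) :
    windowSum 5 a (n + 1) = windowSum 5 a n + a (n + 1) - a (n - 4) := by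
  rw [windowSum_five, windowSum_five, show n + 1 - 1 = n by ring, show n + 1 - 2 = n - 1 by ring,
    show n + 1 - 3 = n - 2 by ring, show n + 1 - 4 = n - 3 by ring]
  ring

/-- The sequence that starts with `1, 2, 2` and then increases exactly when the next value of the
window sum has been reached. -/
structure IsGreedy (a : ℤ → ℤ) : Prop where
  nonpos : ∀ k : ℤ, k ≤ 0 → a k = 0
  one : a 1 = 1
  two : a 2 = 2
  three : a 3 = 2
  succ : ∀ k : ℤ, 3 ≤ k → a (k + 1) = a k + if windowSum 5 a (a k + 1) ≤ k + 1 then 1 else 0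

/-- The greedy sequence, indexed by the natural numbers. -/
def greedyNat : ℕ → ℕ
  | 0 => 0
  | 1 => 1
  | 2 => 2
  | 3 => 2
  | k + 4 => greedyNat (k + 3) +
      if (if h : greedyNat (k + 3) + 1 < k + 4 then greedyNat (greedyNat (k + 3) + 1) else 0) +
        (if h : greedyNat (k + 3) < k + 4 then greedyNat (greedyNat (k + 3)) else 0) +
        (if h : greedyNat (k + 3) - 1 < k + 4 then greedyNat (greedyNat (k + 3) - 1) else 0) +
        (if h : greedyNat (k + 3) - 2 < k + 4 then greedyNat (greedyNat (k + 3) - 2) else 0) +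
        (if h : greedyNat (k + 3) - 3 < k + 4 then greedyNat (greedyNat (k + 3) - 3) else 0) ≤ k + 4
      then 1 else 0

/-- The guards in the recursion only secure termination; this bound shows that they always hold. -/
theorem greedyNat_lt (k : ℕ) : greedyNat (k + 3) + 1 < k + 4 := by
  induction k with
  | zero => simp [greedyNat]
  | succ k ih =>
    rw [show k + 1 + 3 = k + 4 by ring, greedyNat]
    split_ifs <;> omega

theorem greedyNat_succ (k : ℕ) : greedyNat (k + 4) = greedyNat (k + 3) +
    if greedyNat (greedyNat (k + 3) + 1) + greedyNat (greedyNat (k + 3)) +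
        greedyNat (greedyNat (k + 3) - 1) + greedyNat (greedyNat (k + 3) - 2) +
        greedyNat (greedyNat (k + 3) - 3) ≤ k + 4
      then 1 else 0 := by
  have h := greedyNat_lt k
  rw [greedyNat, dif_pos (by omega), dif_pos (by omega), dif_pos (by omega), dif_pos (by omega),
    dif_pos (by omega)]

theorem exists_isGreedy : ∃ a : ℤ → ℤ, IsGreedy a := by
  refine ⟨fun k => greedyNat k.toNat, fun k hk => ?_, ?_, ?_, ?_, fun k hk => ?_⟩
  · simp [Int.toNat_of_nonpos hk, greedyNat]
  · simp [greedyNat]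
  · simp [greedyNat]
  · simp [greedyNat]
  · obtain ⟨m, rfl⟩ : ∃ m : ℕ, k = m + 3 := ⟨(k - 3).toNat, by omega⟩
    have h := greedyNat_succ m
    simp only [windowSum_five]
    have e1 : ((m : ℤ) + 3 + 1).toNat = m + 4 := by omega
    have e2 : ((m : ℤ) + 3).toNat = m + 3 := by omega
    rw [e1, e2, h]
    generalize greedyNat (m + 3) = p
    have e3 : ((p : ℤ) + 1).toNat = p + 1 := by omega
    have e4 : ((p : ℤ) + 1 - 1).toNat = p := by omega
    -- Truncated subtraction is harmless: nonpositive indices all collapse to 0, where the value is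
    -- 0 as required.
    have e5 : ((p : ℤ) + 1 - 2).toNat = p - 1 := by omega
    have e6 : ((p : ℤ) + 1 - 3).toNat = p - 2 := by omega
    have e7 : ((p : ℤ) + 1 - 4).toNat = p - 3 := by omega
    rw [e3, e4, e5, e6, e7]
    push_cast
    split_ifs <;> omega

namespace IsGreedy

variable {a : ℤ → ℤ}

theorem le_succ_le (h : IsGreedy a) (k : ℤ) : a k ≤ a (k + 1) ∧ a (k + 1) ≤ a k + 1 := by
  rcases le_or_gt 3 k with hk | hk
  · rw [h.succ k hk]
    split_ifs <;> omega
  · rcases lt_or_ge k 0 with h0 | h0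
    · rw [h.nonpos k (by omega), h.nonpos (k + 1) (by omega)]
      omega
    · have h1 := h.one
      have h2 := h.two
      have h3 := h.three
      have h4 := h.nonpos 0 le_rfl
      interval_cases k <;> norm_num <;> omega

theorem monotone (h : IsGreedy a) : Monotone a :=
  monotone_int_of_le_succ fun k => (h.le_succ_le k).1

theorem apply_add_one_le (h : IsGreedy a) : ∀ k : ℤ, 3 ≤ k → a k + 1 ≤ k := by
  refine Int.leInduction ?_ fun k hk ih => ?_
  · rw [h.three]; norm_num
  · have := (h.le_succ_le k).2
    omega

theorem values (h : IsGreedy a) :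
    a 4 = 2 ∧ a 5 = 3 ∧ a 6 = 3 ∧ a 7 = 4 ∧ a 8 = 4 ∧ a 9 = 4 ∧ a 10 = 5 ∧ a 11 = 5 ∧ a 12 = 6 ∧
    a 13 = 6 ∧ a 14 = 7 ∧ a 15 = 7 ∧ a 16 = 8 ∧ a 17 = 8 ∧ a 18 = 9 ∧ a 19 = 9 ∧ a 20 = 10 := by
  have a0 := h.nonpos 0 (by norm_num)
  have b1 := h.nonpos (-1) (by norm_num)
  have b2 := h.nonpos (-2) (by norm_num)
  have a1 := h.one
  have a2 := h.two
  have a3 := h.three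
  have a4 : a 4 = 2 := by simpa [windowSum_five, a0, b1, b2, a1, a2, a3] using h.succ 3 (by norm_num)
  have a5 : a 5 = 3 := by simpa [windowSum_five, a0, b1, b2, a1, a2, a3, a4] using h.succ 4 (by norm_num)
  have a6 : a 6 = 3 := by
    simpa [windowSum_five, a0, a1, a2, a3, a4, a5] using h.succ 5 (by norm_num)
  have a7 : a 7 = 4 := by
    simpa [windowSum_five, a0, a1, a2, a3, a4, a5, a6] using h.succ 6 (by norm_num)
  have a8 : a 8 = 4 := by
    simpa [windowSum_five, a1, a2, a3, a4, a5, a6, a7] using h.succ 7 (by norm_num)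
  have a9 : a 9 = 4 := by
    simpa [windowSum_five, a1, a2, a3, a4, a5, a6, a7, a8] using h.succ 8 (by norm_num)
  have a10 : a 10 = 5 := by
    simpa [windowSum_five, a1, a2, a3, a4, a5, a6, a7, a8, a9] using h.succ 9 (by norm_num)
  have a11 : a 11 = 5 := by
    simpa [windowSum_five, a2, a3, a4, a5, a6, a7, a8, a9, a10] using h.succ 10 (by norm_num)
  have a12 : a 12 = 6 := by
    simpa [windowSum_five, a2, a3, a4, a5, a6, a7, a8, a9, a11] using h.succ 11 (by norm_num)
  have a13 : a 13 = 6 := by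
    simpa [windowSum_five, a2, a3, a4, a5, a6, a7, a8, a9, a12] using h.succ 12 (by norm_num)
  have a14 : a 14 = 7 := by
    simpa [windowSum_five, a2, a3, a4, a5, a6, a7, a8, a9, a13] using h.succ 13 (by norm_num)
  have a15 : a 15 = 7 := by
    simpa [windowSum_five, a3, a4, a5, a6, a7, a8, a9, a14] using h.succ 14 (by norm_num)
  have a16 : a 16 = 8 := by
    simpa [windowSum_five, a3, a4, a5, a6, a7, a8, a9, a15] using h.succ 15 (by norm_num)
  have a17 : a 17 = 8 := by
    simpa [windowSum_five, a4, a5, a6, a7, a8, a9, a16] using h.succ 16 (by norm_num)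
  have a18 : a 18 = 9 := by
    simpa [windowSum_five, a4, a5, a6, a7, a8, a9, a17] using h.succ 17 (by norm_num)
  have a19 : a 19 = 9 := by
    simpa [windowSum_five, a5, a6, a7, a8, a9, a10, a18] using h.succ 18 (by norm_num)
  have a20 : a 20 = 10 := by
    simpa [windowSum_five, a5, a6, a7, a8, a9, a10, a19] using h.succ 19 (by norm_num)
  exact ⟨a4, a5, a6, a7, a8, a9, a10, a11, a12, a13, a14, a15, a16, a17, a18, a19, a20⟩

/-- The two claims need each other. The gap `a (k-5) < a k` makes `T` strictly increasing, which
keeps `k` below the next window sum after an increment. Conversely, unit steps give `T (n+1) ≤ T n +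
5`, so no value can persist for more than five indices. -/
theorem windowSum_bracket_aux (h : IsGreedy a) : ∀ N : ℤ, 1 ≤ N →
    ∀ k, 1 ≤ k → k ≤ N → a (k - 5) + 1 ≤ a k ∧
      (3 ≤ k → windowSum 5 a (a k) ≤ k ∧ k < windowSum 5 a (a k + 1)) := by
  refine Int.leInduction ?_ fun N hN ih => ?_
  · intro k h1 h2
    obtain rfl : k = 1 := by omega
    rw [h.one, h.nonpos _ (by norm_num)]
    norm_num
  intro k h1 hk
  rcases hk.lt_or_eq with hk | rfl
  · exact ih k h1 (by omega)
  obtain ⟨a4, a5, a6, a7, -⟩ := h.values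
  have a1 := h.one
  have a2 := h.two
  have a3 := h.three
  have gap : a (N + 1 - 5) + 1 ≤ a (N + 1) := by
    rcases le_or_gt N 4 with h4 | h4
    · rw [h.nonpos (N + 1 - 5) (by omega)]
      have := h.monotone h1
      omega
    rcases le_or_gt 7 N with h7 | h7
    · have p1 := ((ih (N + 1 - 5) (by omega) (by omega)).2 (by omega)).1
      have p2 := windowSum_succ a (a (N + 1 - 5))
      have s := h.succ N (by omega)
      have m1 := h.monotone (show N + 1 - 5 ≤ N by omega)
      set n := a (N + 1 - 5)
      have l1 := (h.le_succ_le n).2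
      have l2 := (h.le_succ_le (n - 1)).2
      have l3 := (h.le_succ_le (n - 2)).2
      have l4 := (h.le_succ_le (n - 3)).2
      have l5 := (h.le_succ_le (n - 4)).2
      rw [show n - 1 + 1 = n by ring] at l2
      rw [show n - 2 + 1 = n - 1 by ring] at l3
      rw [show n - 3 + 1 = n - 2 by ring] at l4
      rw [show n - 4 + 1 = n - 3 by ring] at l5
      rcases m1.lt_or_eq with m1 | m1
      · split_ifs at s <;> omega
      -- If `a` has stayed at `n` from `N-4` to `N`, then `T (n+1) ≤ T n + 5 ≤ N+1`, so the greedy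
      -- rule increments now.
      · rw [← m1, if_pos (by omega)] at s
        omega
    · have : N = 5 ∨ N = 6 := by omega
      rcases this with rfl | rfl <;> norm_num <;> omega
  refine ⟨gap, fun h3 => ?_⟩
  rcases h3.lt_or_eq with h3 | h3
  · obtain ⟨p1, p2⟩ := (ih N hN le_rfl).2 (by omega)
    have s := h.succ N (by omega)
    have u := h.apply_add_one_le N (by omega)
    have v := h.monotone (show 3 ≤ N by omega)
    have w := windowSum_succ a (a N + 1)
    by_cases c : windowSum 5 a (a N + 1) ≤ N + 1
    · rw [if_pos c] at s
      rw [s]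
      refine ⟨c, ?_⟩
      -- The gap is needed at index `a N + 2 ≤ N + 1`; in the extreme case it is the one just
      -- proved.
      have g : a (a N + 1 - 4) + 1 ≤ a (a N + 1 + 1) := by
        rcases (show a N + 1 ≤ N from u).lt_or_eq with u | u
        · have := (ih (a N + 1 + 1) (by omega) (by omega)).1
          rwa [show a N + 1 + 1 - 5 = a N + 1 - 4 by ring] at this
        · rw [u]
          rwa [show N + 1 - 5 = N - 4 by ring] at gap
      omega
    · rw [if_neg c, add_zero] at s
      rw [s]
      omega
  · rw [← h3, a3]
    norm_num [windowSum_five, a1, a2, a3, h.nonpos]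

theorem lt_add_five (h : IsGreedy a) {k : ℤ} (hk : 1 ≤ k) : a (k - 5) + 1 ≤ a k :=
  (h.windowSum_bracket_aux k hk k hk le_rfl).1

theorem windowSum_lt_succ (h : IsGreedy a) {k : ℤ} (hk : 0 ≤ k) :
    windowSum 5 a k < windowSum 5 a (k + 1) := by
  have := h.lt_add_five (show 1 ≤ k + 1 by omega)
  rw [show k + 1 - 5 = k - 4 by ring] at this
  have := windowSum_succ a k
  omega

theorem windowSum_lt (h : IsGreedy a) {m n : ℤ} (hm : 0 ≤ m) (hn : m < n) :
    windowSum 5 a m < windowSum 5 a n := by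
  induction n, (show m + 1 ≤ n from hn) using Int.leInduction with
  | base => exact h.windowSum_lt_succ hm
  | succ n hn ih => exact (ih (by omega)).trans (h.windowSum_lt_succ (by omega))

/-- The greedy sequence inverts its window sum. -/
theorem eq_of_windowSum (h : IsGreedy a) {k n : ℤ} (hn : 2 ≤ n) (h1 : windowSum 5 a n ≤ k)
    (h2 : k < windowSum 5 a (n + 1)) : a k = n := by
  have w2 : windowSum 5 a 2 = 3 := by
    norm_num [windowSum_five, h.one, h.two, h.nonpos]
  have k3 : 3 ≤ k := by
    rcases hn.lt_or_eq with hn | rfl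
    · have := h.windowSum_lt (by norm_num) hn
      omega
    · omega
  obtain ⟨p1, p2⟩ := (h.windowSum_bracket_aux k (by omega) k (by omega) le_rfl).2 k3
  have pos := h.monotone k3
  rw [h.three] at pos
  rcases lt_trichotomy (a k) n with c | c | c
  · rcases (show a k + 1 ≤ n by omega).lt_or_eq with d | d
    · have := h.windowSum_lt (by omega) d
      omega
    · rw [d] at p2; omega
  · exact c
  · rcases (show n + 1 ≤ a k by omega).lt_or_eq with d | d
    · have := h.windowSum_lt (by omega) d
      omega
    · rw [← d] at p1; omega

theorem isWindowSolution (h : IsGreedy a) : IsWindowSolution 5 a where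
  eq_zero := h.nonpos
  pos n hn := by
    have := h.monotone hn
    rw [h.one] at this
    omega
  mono m n _ hmn := h.monotone hmn
  nested n hn := by
    rcases hn.lt_or_eq with hn | rfl
    · exact h.eq_of_windowSum hn le_rfl (h.windowSum_lt_succ (by omega))
    · norm_num [windowSum_five, h.one, h.nonpos]

theorem isAlmostGolomb (h : IsGreedy a) : IsAlmostGolomb 5 a where
  toIsWindowSolution := h.isWindowSolution
  minimal b hb n hn heq := by
    rcases hn.lt_or_eq with hn | rfl
    · rcases (show 2 ≤ n from hn).lt_or_eq with hn | rfl
      · obtain ⟨p1, p2⟩ :=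
          (h.windowSum_bracket_aux n (by omega) n (by omega) le_rfl).2 (by omega)
        have u := h.apply_add_one_le n (by omega)
        -- As `a n < n`, both sequences have the same window there. Thus `b` takes the value `a n`
        -- at `T (a n) ≤ n`, and monotonicity of `b` finishes.
        have w : windowSum 5 b (a n) = windowSum 5 a (a n) := by
          simp only [windowSum_five]
          rw [heq _ (by omega), heq _ (by omega), heq _ (by omega), heq _ (by omega),
            heq _ (by omega)]
        have pos := h.isWindowSolution.pos n (by omega)
        have v := hb.nested (a n) (by omega)
        rw [w] at v
        have p0 : windowSum 5 a 0 < windowSum 5 a (a n) := h.windowSum_lt le_rfl pos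
        have w0 : windowSum 5 a 0 = 0 := by norm_num [windowSum_five, h.nonpos]
        have := hb.mono (windowSum 5 a (a n)) n (by omega) p1
        omega
      · have b1 : b 1 = 1 := by rw [heq 1 (by norm_num), h.one]
        have p := hb.mono 1 2 (by norm_num) (by norm_num)
        have v := hb.nested 2 (by norm_num)
        rw [h.two]
        by_contra c
        have b2 : b 2 = 1 := by omega
        norm_num [windowSum_five, b1, b2, hb.eq_zero] at v
    · rw [h.one]
      exact hb.pos 1 le_rfl

end IsGreedy

theorem IsAlmostGolomb.unique {r : ℕ} {a b : ℤ → ℤ} (ha : IsAlmostGolomb r a)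
    (hb : IsAlmostGolomb r b) : a = b := by
  have key : ∀ N : ℤ, 0 ≤ N → ∀ k ≤ N, a k = b k := by
    refine Int.leInduction (fun k hk => ?_) fun N hN ih k hk => ?_
    · rw [ha.eq_zero k hk, hb.eq_zero k hk]
    · rcases hk.lt_or_eq with hk | rfl
      · exact ih k (by omega)
      · refine le_antisymm (ha.minimal b hb.toIsWindowSolution _ (by omega) fun k hk => ?_)
          (hb.minimal a ha.toIsWindowSolution _ (by omega) fun k hk => ?_)
        · exact (ih k (by omega)).symm
        · exact ih k (by omega)
  funext k
  exact key (max k 0) (le_max_right _ _) k (le_max_left _ _)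

end AlmostGolomb

/-! ### Jumps of the window sum and the denesting formulas -/

namespace AlmostGolomb

/-- The excess over `2` of the gap between consecutive window sums. -/
def jump (a : ℤ → ℤ) (n : ℤ) : ℤ := windowSum 5 a (n + 1) - windowSum 5 a n - 2

theorem jump_eq (a : ℤ → ℤ) (n : ℤ) : jump a n = a (n + 1) - a (n - 4) - 2 := by
  rw [jump, windowSum_succ]
  ring

theorem windowSum_add_one (a : ℤ → ℤ) (n : ℤ) :
    windowSum 5 a (n + 1) = windowSum 5 a n + 2 + jump a n := by
  rw [jump]; ring

theorem windowSum_add_two (a : ℤ → ℤ) (n : ℤ) :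
    windowSum 5 a (n + 2) = windowSum 5 a n + 4 + jump a n + jump a (n + 1) := by
  rw [show n + 2 = n + 1 + 1 by ring, windowSum_add_one, windowSum_add_one]; ring

theorem windowSum_add_three (a : ℤ → ℤ) (n : ℤ) :
    windowSum 5 a (n + 3) = windowSum 5 a n + 6 + jump a n + jump a (n + 1) + jump a (n + 2) := by
  rw [show n + 3 = n + 2 + 1 by ring, windowSum_add_one, windowSum_add_two]; ring

theorem windowSum_add_four (a : ℤ → ℤ) (n : ℤ) :
    windowSum 5 a (n + 4) = windowSum 5 a n + 8 + jump a n + jump a (n + 1) + jump a (n + 2) +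
      jump a (n + 3) := by
  rw [show n + 4 = n + 3 + 1 by ring, windowSum_add_one, windowSum_add_three]; ring

/-- The values of `a` on the residue block `5n, …, 5n+4`, in terms of the window sum. -/
structure Denests (a : ℤ → ℤ) (n : ℤ) : Prop where
  zero : a (5 * n) = windowSum 5 a n + 2 + jump a n
  one : a (5 * n + 1) = windowSum 5 a n + 3
  two : a (5 * n + 2) = windowSum 5 a n + 3 + jump a n
  three : a (5 * n + 3) = windowSum 5 a n + 3 + jump a n + jump a (n + 1)
  four : a (5 * n + 4) = windowSum 5 a n + 4 + jump a n

namespace Denests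

variable {a : ℤ → ℤ} {m : ℤ}

/-- By `jump_eq`, a jump compares `a` at two indices five apart, so the same denesting formula
applies to both, for consecutive arguments, and the difference telescopes. The next four lemmas
follow the same pattern. -/
theorem jump_zero (h' : Denests a (m - 1)) (h : Denests a m) : jump a (5 * m) = jump a (m - 1) := by
  have h1 := h.one
  have h2 := h'.one
  rw [show 5 * (m - 1) + 1 = 5 * m - 4 by ring] at h2
  rw [jump_eq, h1, h2, jump, sub_add_cancel]
  ring

theorem jump_one (h' : Denests a (m - 1)) (h : Denests a m) : jump a (5 * m + 1) = jump a m := by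
  have h1 := h.two
  have h2 := h'.two
  have h3 := windowSum_add_one a (m - 1)
  rw [sub_add_cancel] at h3
  rw [show 5 * (m - 1) + 2 = 5 * m + 1 - 4 by ring] at h2
  rw [jump_eq, add_assoc, show (1 : ℤ) + 1 = 2 by norm_num, h1, h2]
  omega

theorem jump_two (h' : Denests a (m - 1)) (h : Denests a m) :
    jump a (5 * m + 2) = jump a (m + 1) := by
  have h1 := h.three
  have h2 := h'.three
  have h3 := windowSum_add_one a (m - 1)
  rw [sub_add_cancel] at h3
  rw [show 5 * (m - 1) + 3 = 5 * m + 2 - 4 by ring, sub_add_cancel] at h2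
  rw [jump_eq, add_assoc, show (2 : ℤ) + 1 = 3 by norm_num, h1, h2]
  omega

theorem jump_three (h' : Denests a (m - 1)) (h : Denests a m) : jump a (5 * m + 3) = jump a m := by
  have h1 := h.four
  have h2 := h'.four
  have h3 := windowSum_add_one a (m - 1)
  rw [sub_add_cancel] at h3
  rw [show 5 * (m - 1) + 4 = 5 * m + 3 - 4 by ring] at h2
  rw [jump_eq, add_assoc, show (3 : ℤ) + 1 = 4 by norm_num, h1, h2]
  omega

theorem jump_four (h : Denests a m) (h' : Denests a (m + 1)) :
    jump a (5 * m + 4) = jump a (m + 1) := by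
  have h1 := h'.zero
  have h2 := h.zero
  have h3 := windowSum_add_one a m
  rw [jump_eq, add_sub_cancel_right, show 5 * m + 4 + 1 = 5 * (m + 1) by ring, h1, h2]
  omega

end Denests

namespace IsGreedy

variable {a : ℤ → ℤ}

-- With `t = T n`, the hypotheses fix `a` from `t-2` up to the start of the block of `n+2`. This
-- determines or bounds `T (t+2), …, T (t+6)` closely enough to locate each `5n+d` between two
-- consecutive window sums, and `eq_of_windowSum` reads off `a (5n+d)`.
set_option maxHeartbeats 1000000 in
theorem denests_of_jump (h : IsGreedy a) {n : ℤ} (hn : 3 ≤ n) (hp : 0 ≤ jump a (n - 1))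
    (h0 : 0 ≤ jump a n) (h1 : 0 ≤ jump a (n + 1)) (hs : jump a n + jump a (n + 1) ≤ 1) :
    Denests a n := by
  have ep := windowSum_add_one a (n - 1)
  have e0 := windowSum_add_one a n
  have e1 := windowSum_add_two a n
  rw [sub_add_cancel] at ep
  have l3 := h.windowSum_lt_succ (show 0 ≤ n + 2 by omega)
  obtain ⟨t, ht⟩ : ∃ t, windowSum 5 a n = t := ⟨_, rfl⟩
  have block : ∀ k, windowSum 5 a n ≤ k → k < windowSum 5 a (n + 1) → a k = n :=
    fun k => h.eq_of_windowSum (by omega)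
  have blockp : ∀ k, windowSum 5 a (n - 1) ≤ k → k < windowSum 5 a n → a k = n - 1 := fun k hk hk' =>
    h.eq_of_windowSum (by omega) hk (by rwa [sub_add_cancel])
  have block1 : ∀ k, windowSum 5 a (n + 1) ≤ k → k < windowSum 5 a (n + 2) → a k = n + 1 :=
    fun k hk hk' => h.eq_of_windowSum (by omega) hk
      (by rwa [add_assoc, show (1 : ℤ) + 1 = 2 by norm_num])
  have block2 : a (windowSum 5 a (n + 2)) = n + 2 := h.eq_of_windowSum (by omega) le_rfl l3
  have bracket : ∀ k c : ℤ, 2 ≤ c → windowSum 5 a c ≤ k → k < windowSum 5 a (c + 1) → a k = c :=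
    fun k c => h.eq_of_windowSum
  have tpos : 5 ≤ t := by
    rcases hn.lt_or_eq with hn | rfl
    · have := h.windowSum_lt (by norm_num) hn
      have w : windowSum 5 a 3 = 5 := by
        norm_num [windowSum_five, h.one, h.two, h.three, h.nonpos]
      omega
    · rw [← ht]
      norm_num [windowSum_five, h.one, h.two, h.three, h.nonpos]
  have v0 : a t = n := block t (by omega) (by omega)
  have v1 : a (t + 1) = n := block _ (by omega) (by omega)
  have u1 : a (t - 1) = n - 1 := blockp _ (by omega) (by omega)
  have u2 : a (t - 2) = n - 1 := blockp _ (by omega) (by omega)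
  have w2 : windowSum 5 a (t + 2) = a (t + 2) + a (t + 1) + a t + a (t - 1) + a (t - 2) := by
    rw [windowSum_five]; ring_nf
  have w3 : windowSum 5 a (t + 3) = a (t + 3) + a (t + 2) + a (t + 1) + a t + a (t - 1) := by
    rw [windowSum_five]; ring_nf
  have w4 : windowSum 5 a (t + 4) = a (t + 4) + a (t + 3) + a (t + 2) + a (t + 1) + a t := by
    rw [windowSum_five]; ring_nf
  have w5 : windowSum 5 a (t + 5) = a (t + 5) + a (t + 4) + a (t + 3) + a (t + 2) + a (t + 1) := by
    rw [windowSum_five]; ring_nf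
  have w6 : windowSum 5 a (t + 6) = a (t + 6) + a (t + 5) + a (t + 4) + a (t + 3) + a (t + 2) := by
    rw [windowSum_five]; ring_nf
  -- Past the start of the block of `n+2`, lower bounds on `a` suffice.
  have m5 : a (t + 4) ≤ a (t + 5) := h.monotone (by omega)
  have m6 : a (t + 5) ≤ a (t + 6) := h.monotone (by omega)
  have bracket2 : ∀ k, windowSum 5 a (t + 2) ≤ k → k < windowSum 5 a (t + 3) → a k = t + 2 :=
    fun k hk hk' => bracket k _ (by omega) hk
      (by rwa [add_assoc, show (2 : ℤ) + 1 = 3 by norm_num])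
  have bracket3 : ∀ k, windowSum 5 a (t + 3) ≤ k → k < windowSum 5 a (t + 4) → a k = t + 3 :=
    fun k hk hk' => bracket k _ (by omega) hk
      (by rwa [add_assoc, show (3 : ℤ) + 1 = 4 by norm_num])
  have bracket4 : ∀ k, windowSum 5 a (t + 4) ≤ k → k < windowSum 5 a (t + 5) → a k = t + 4 :=
    fun k hk hk' => bracket k _ (by omega) hk
      (by rwa [add_assoc, show (4 : ℤ) + 1 = 5 by norm_num])
  have bracket5 : ∀ k, windowSum 5 a (t + 5) ≤ k → k < windowSum 5 a (t + 6) → a k = t + 5 :=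
    fun k hk hk' => bracket k _ (by omega) hk
      (by rwa [add_assoc, show (5 : ℤ) + 1 = 6 by norm_num])
  clear bracket blockp ep hp tpos l3
  -- The blocks of `n` and `n+1` have lengths 2 and 2, 2 and 3, or 3 and 2.
  have cases : (jump a n = 0 ∧ jump a (n + 1) = 0) ∨ (jump a n = 0 ∧ jump a (n + 1) = 1) ∨
      (jump a n = 1 ∧ jump a (n + 1) = 0) := by omega
  rcases cases with ⟨j0, j1⟩ | ⟨j0, j1⟩ | ⟨j0, j1⟩
  · have v2 : a (t + 2) = n + 1 := block1 _ (by omega) (by omega)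
    have v3 : a (t + 3) = n + 1 := block1 _ (by omega) (by omega)
    have v4 : a (t + 4) = n + 2 := by rw [← block2]; congr 1; omega
    constructor <;> simp only [ht, j0, j1]
    · rw [bracket2] <;> omega
    · rw [bracket3] <;> omega
    · rw [bracket3] <;> omega
    · rw [bracket3] <;> omega
    · rw [bracket4] <;> omega
  · have v2 : a (t + 2) = n + 1 := block1 _ (by omega) (by omega)
    have v3 : a (t + 3) = n + 1 := block1 _ (by omega) (by omega)
    have v4 : a (t + 4) = n + 1 := block1 _ (by omega) (by omega)
    have v5 : a (t + 5) = n + 2 := by rw [← block2]; congr 1; omega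
    constructor <;> simp only [ht, j0, j1]
    · rw [bracket2] <;> omega
    · rw [bracket3] <;> omega
    · rw [bracket3] <;> omega
    · rw [bracket4] <;> omega
    · rw [bracket4] <;> omega
  · have v2 : a (t + 2) = n := block _ (by omega) (by omega)
    have v3 : a (t + 3) = n + 1 := block1 _ (by omega) (by omega)
    have v4 : a (t + 4) = n + 1 := block1 _ (by omega) (by omega)
    have v5 : a (t + 5) = n + 2 := by rw [← block2]; congr 1; omega
    constructor <;> simp only [ht, j0, j1]
    · rw [bracket3] <;> omega
    · rw [bracket3] <;> omega
    · rw [bracket4] <;> omega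
    · rw [bracket4] <;> omega
    · rw [bracket5] <;> omega

theorem jump_init (h : IsGreedy a) {n : ℤ} (h1 : 1 ≤ n) (h2 : n ≤ 19) :
    jump a n = if n ∈ ({4, 13, 15, 17, 19} : Finset ℤ) then 1 else 0 := by
  obtain ⟨a4, a5, a6, a7, a8, a9, a10, a11, a12, a13, a14, a15, a16, a17, a18, a19, a20⟩ := h.values
  have a0 := h.nonpos 0 (by norm_num)
  have b1 := h.nonpos (-1) (by norm_num)
  have b2 := h.nonpos (-2) (by norm_num)
  have b3 := h.nonpos (-3) (by norm_num)
  have a1 := h.one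
  have a2 := h.two
  have a3 := h.three
  rw [jump_eq]
  interval_cases n <;> norm_num [*]

/-- Strong induction: the jumps at `5m+d-1` and `5m+d` are those at `m-1, m` or at `m, m+1`, in some
order, so adjacent ones cannot appear. The base reaches 19 because denesting at `m-1` needs `m ≥ 4`.
-/
theorem jump_binary_aux (h : IsGreedy a) : ∀ N : ℤ, 19 ≤ N → ∀ k, 1 ≤ k → k ≤ N →
    0 ≤ jump a k ∧ jump a (k - 1) + jump a k ≤ 1 := by
  refine Int.leInduction (fun k h1 h2 => ?_) fun N hN ih k h1 h2 => ?_
  · have e := h.jump_init h1 h2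
    have e0 : jump a 0 = -1 := by
      norm_num [jump_eq, h.one, h.nonpos]
    rcases h1.lt_or_eq with h1 | rfl
    · rw [e, h.jump_init (n := k - 1) (by omega) (by omega)]
      clear e
      interval_cases k <;> decide
    · norm_num [e, e0]
  rcases h2.lt_or_eq with h2 | rfl
  · exact ih k h1 (by omega)
  obtain ⟨m, d, hd0, hd5, hm⟩ : ∃ m d : ℤ, 0 ≤ d ∧ d ≤ 4 ∧ N + 1 = 5 * m + d :=
    ⟨(N + 1) / 5, (N + 1) % 5, by omega, by omega, by omega⟩
  have den : ∀ n, 3 ≤ n → n ≤ m + 1 → Denests a n := fun n hn hn' => by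
    have i1 := ih (n - 1) (by omega) (by omega)
    have i2 := ih n (by omega) (by omega)
    have i3 := ih (n + 1) (by omega) (by omega)
    rw [add_sub_cancel_right] at i3
    exact h.denests_of_jump hn i1.1 i2.1 i3.1 i3.2
  have i1 := ih (m - 1) (by omega) (by omega)
  have i2 := ih m (by omega) (by omega)
  have i3 := ih (m + 1) (by omega) (by omega)
  rw [add_sub_cancel_right] at i3
  have D' := den (m - 1) (by omega) (by omega)
  have D := den m (by omega) (by omega)
  have D1 := den (m + 1) (by omega) (by omega)
  rw [← sub_add_cancel m 1] at D
  have r4 := D'.jump_four D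
  rw [sub_add_cancel] at D r4
  rw [hm]
  obtain rfl | rfl | rfl | rfl | rfl : d = 0 ∨ d = 1 ∨ d = 2 ∨ d = 3 ∨ d = 4 := by omega
  · rw [add_zero, D'.jump_zero D, show 5 * m - 1 = 5 * (m - 1) + 4 by ring, r4]
    omega
  · rw [add_sub_cancel_right, D'.jump_zero D, D'.jump_one D]
    omega
  · rw [show 5 * m + 2 - 1 = 5 * m + 1 by ring, D'.jump_one D, D'.jump_two D]
    omega
  · rw [show 5 * m + 3 - 1 = 5 * m + 2 by ring, D'.jump_two D, D'.jump_three D]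
    omega
  · rw [show 5 * m + 4 - 1 = 5 * m + 3 by ring, D'.jump_three D, D.jump_four D1]
    omega

theorem jump_nonneg (h : IsGreedy a) {n : ℤ} (hn : 1 ≤ n) : 0 ≤ jump a n :=
  (h.jump_binary_aux (max n 19) (le_max_right _ _) n hn (le_max_left _ _)).1

theorem jump_add_jump_succ (h : IsGreedy a) {n : ℤ} (hn : 0 ≤ n) :
    jump a n + jump a (n + 1) ≤ 1 := by
  have := (h.jump_binary_aux (max (n + 1) 19) (le_max_right _ _) (n + 1) (by omega)
    (le_max_left _ _)).2
  rwa [add_sub_cancel_right] at this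

theorem jump_eq_zero_or_one (h : IsGreedy a) {n : ℤ} (hn : 1 ≤ n) : jump a n = 0 ∨ jump a n = 1 := by
  have h1 := h.jump_nonneg hn
  have h2 := h.jump_nonneg (n := n + 1) (by omega)
  have h3 := h.jump_add_jump_succ (n := n) (by omega)
  omega

theorem denests (h : IsGreedy a) {n : ℤ} (hn : 3 ≤ n) : Denests a n :=
  h.denests_of_jump hn (h.jump_nonneg (by omega)) (h.jump_nonneg (by omega))
    (h.jump_nonneg (by omega)) (h.jump_add_jump_succ (by omega))

/-- This rule fails at `m = 3`, where `jump 15 = 1` and `jump 2 = 0`; the other four residues do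
allow `m = 3`. -/
theorem jump_five_mul (h : IsGreedy a) {m : ℤ} (hm : 4 ≤ m) : jump a (5 * m) = jump a (m - 1) :=
  (h.denests (by omega)).jump_zero (h.denests (by omega))

theorem jump_five_mul_add_one (h : IsGreedy a) {m : ℤ} (hm : 3 ≤ m) :
    jump a (5 * m + 1) = jump a m := by
  rcases hm.lt_or_eq with hm | rfl
  · exact (h.denests (by omega)).jump_one (h.denests (by omega))
  · rw [h.jump_init (by norm_num) (by norm_num), h.jump_init (by norm_num) (by norm_num)]
    decide

theorem jump_five_mul_add_two (h : IsGreedy a) {m : ℤ} (hm : 3 ≤ m) :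
    jump a (5 * m + 2) = jump a (m + 1) := by
  rcases hm.lt_or_eq with hm | rfl
  · exact (h.denests (by omega)).jump_two (h.denests (by omega))
  · rw [h.jump_init (by norm_num) (by norm_num), h.jump_init (by norm_num) (by norm_num)]
    decide

theorem jump_five_mul_add_three (h : IsGreedy a) {m : ℤ} (hm : 3 ≤ m) :
    jump a (5 * m + 3) = jump a m := by
  rcases hm.lt_or_eq with hm | rfl
  · exact (h.denests (by omega)).jump_three (h.denests (by omega))
  · rw [h.jump_init (by norm_num) (by norm_num), h.jump_init (by norm_num) (by norm_num)]
    decide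

theorem jump_five_mul_add_four (h : IsGreedy a) {m : ℤ} (hm : 3 ≤ m) :
    jump a (5 * m + 4) = jump a (m + 1) :=
  (h.denests hm).jump_four (h.denests (by omega))

/-! ### The correctors as jumps: recurrences, transitions and tables -/

theorem eps_eq (h : IsGreedy a) {n : ℤ} (hn : 1 ≤ n) : eps a n = jump a n := by
  rcases le_or_gt 3 n with h3 | h3
  · rw [eps, (h.denests h3).zero]; ring
  · obtain ⟨-, a5, -, -, -, -, a10, -⟩ := h.values
    rw [h.jump_init hn (by omega)]
    interval_cases n <;> norm_num [eps, windowSum_five, h.one, h.two, h.nonpos, a5, a10]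

theorem eta_eq (h : IsGreedy a) {n : ℤ} (hn : 1 ≤ n) : eta a n = jump a (n + 1) := by
  rcases le_or_gt 3 n with h3 | h3
  · rw [eta, (h.denests h3).two, windowSum_add_two]; ring
  · obtain ⟨a4, -, -, a7, -, -, -, -, a12, -⟩ := h.values
    rw [h.jump_init (by omega) (by omega)]
    interval_cases n <;>
      norm_num [eta, windowSum_five, h.one, h.two, h.three, h.nonpos, a4, a7, a12]

theorem theta_eq (h : IsGreedy a) {n : ℤ} (hn : 3 ≤ n) : theta a n = 1 - jump a (n + 2) := by
  rw [theta, (h.denests hn).three, windowSum_add_three]; ring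

theorem epsFour_eq (h : IsGreedy a) {n : ℤ} (hn : 3 ≤ n) :
    epsFour a n = -2 - jump a (n + 1) - jump a (n + 2) - jump a (n + 3) := by
  rw [epsFour, (h.denests hn).four, windowSum_add_four]; ring

theorem denesting (h : IsGreedy a) {n : ℤ} (hn : 3 ≤ n) :
    a (5 * n) = windowSum 5 a n + 2 + eps a n ∧
    a (5 * n + 1) = windowSum 5 a (n + 1) + 1 - eps a n ∧
    a (5 * n + 2) = windowSum 5 a (n + 2) - 1 - eta a n ∧
    a (5 * n + 3) = windowSum 5 a (n + 3) - 4 + theta a n ∧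
    a (5 * n + 4) = windowSum 5 a (n + 4) - 2 + epsFour a n := by
  refine ⟨by rw [eps]; ring, ?_, by rw [eta]; ring, by rw [theta]; ring, by rw [epsFour]; ring⟩
  rw [(h.denests hn).one, h.eps_eq (by omega), windowSum_add_one]; ring

theorem pair_binary (h : IsGreedy a) {n : ℤ} (hn : 1 ≤ n) :
    (eps a n = 0 ∨ eps a n = 1) ∧ (eta a n = 0 ∨ eta a n = 1) ∧ eps a n * eta a n = 0 := by
  rw [h.eps_eq hn, h.eta_eq hn]
  have h1 := h.jump_eq_zero_or_one hn
  have h2 := h.jump_eq_zero_or_one (n := n + 1) (by omega)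
  have h3 := h.jump_add_jump_succ (n := n) (by omega)
  refine ⟨h1, h2, ?_⟩
  rcases h1 with h1 | h1 <;> rcases h2 with h2 | h2 <;> simp_all

theorem isQuinaryPair (h : IsGreedy a) : IsQuinaryPair (eps a) (eta a) where
  e_init n h1 h2 := by rw [h.eps_eq h1, h.jump_init h1 h2]
  h_init n h1 h2 := by
    rw [h.eta_eq h1]
    rcases h2.lt_or_eq with h2 | rfl
    · rw [h.jump_init (by omega) (by omega)]
      interval_cases n <;> decide
    -- `η 19` is the jump at 20, just beyond the computed values, and comes from the recurrence.
    · rw [show (19 : ℤ) + 1 = 5 * 4 by norm_num, h.jump_five_mul le_rfl,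
        h.jump_init (by norm_num) (by norm_num)]
      decide
  e_zero m hm := by
    rw [h.eps_eq (by omega), h.eps_eq (by omega), h.eps_eq (by omega), h.jump_five_mul hm]
    have h1 := h.jump_eq_zero_or_one (n := m - 1) (by omega)
    have h2 := h.jump_eq_zero_or_one (n := m) (by omega)
    have h3 := h.jump_add_jump_succ (n := m - 1) (by omega)
    rw [sub_add_cancel] at h3
    -- The factor `1 - ε m` is redundant: adjacent jumps are never both 1.
    rcases h1 with h1 | h1 <;> rcases h2 with h2 | h2 <;> simp_all
  e_one m hm := by
    rw [h.eps_eq (by omega), h.eps_eq (by omega), h.jump_five_mul_add_one (by omega)]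
  e_two m hm := by
    rw [h.eps_eq (by omega), h.eta_eq (by omega), h.jump_five_mul_add_two (by omega)]
  e_three m hm := by
    rw [h.eps_eq (by omega), h.eps_eq (by omega), h.jump_five_mul_add_three (by omega)]
  e_four m hm := by
    rw [h.eps_eq (by omega), h.eta_eq (by omega), h.jump_five_mul_add_four (by omega)]
  h_zero m hm := by
    rw [h.eta_eq (by omega), h.eps_eq (by omega), h.jump_five_mul_add_one (by omega)]
  h_one m hm := by
    rw [h.eta_eq (by omega), h.eta_eq (by omega), add_assoc, show (1 : ℤ) + 1 = 2 by norm_num,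
      h.jump_five_mul_add_two (by omega)]
  h_two m hm := by
    rw [h.eta_eq (by omega), h.eps_eq (by omega), add_assoc, show (2 : ℤ) + 1 = 3 by norm_num,
      h.jump_five_mul_add_three (by omega)]
  h_three m hm := by
    rw [h.eta_eq (by omega), h.eta_eq (by omega), add_assoc, show (3 : ℤ) + 1 = 4 by norm_num,
      h.jump_five_mul_add_four (by omega)]
  h_four m hm := by
    rw [h.eta_eq (by omega), h.eps_eq (by omega), show 5 * m + 4 + 1 = 5 * (m + 1) by ring,
      h.jump_five_mul (by omega), add_sub_cancel_right]

/-- Consecutive pairs overlap in `jump m`, so a transition is a binary word of length 3 without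
adjacent ones. There are five such words, and each occurs early. -/
theorem transitions_eq (h : IsGreedy a) :
    {p | ∃ m : ℤ, 3 ≤ m ∧ p = (pairU a (m - 1), pairU a m)} = transitions := by
  have pair : ∀ m, 3 ≤ m → (pairU a (m - 1), pairU a m) =
      ((jump a (m - 1), jump a m), (jump a m, jump a (m + 1))) := fun m hm => by
    rw [pairU, pairU, h.eps_eq (by omega), h.eps_eq (by omega), h.eta_eq (by omega),
      h.eta_eq (by omega), sub_add_cancel]
  have init : ∀ m, 3 ≤ m → m ≤ 18 → (pairU a (m - 1), pairU a m) =
      ((if m - 1 ∈ ({4, 13, 15, 17, 19} : Finset ℤ) then 1 else 0,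
        if m ∈ ({4, 13, 15, 17, 19} : Finset ℤ) then 1 else 0),
       (if m ∈ ({4, 13, 15, 17, 19} : Finset ℤ) then 1 else 0,
        if m + 1 ∈ ({4, 13, 15, 17, 19} : Finset ℤ) then 1 else 0)) := fun m hm hm' => by
    rw [pair m hm, h.jump_init (by omega) (by omega), h.jump_init (by omega) (by omega),
      h.jump_init (by omega) (by omega)]
  ext p
  simp only [Set.mem_ofPred_eq, transitions, Set.mem_insert_iff, Set.mem_singleton_iff]
  constructor
  · rintro ⟨m, hm, rfl⟩
    rw [pair m hm]
    have h1 := h.jump_eq_zero_or_one (n := m - 1) (by omega)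
    have h2 := h.jump_eq_zero_or_one (n := m) (by omega)
    have h3 := h.jump_eq_zero_or_one (n := m + 1) (by omega)
    have s1 := h.jump_add_jump_succ (n := m - 1) (by omega)
    have s2 := h.jump_add_jump_succ (n := m) (by omega)
    rw [sub_add_cancel] at s1
    rcases h1 with h1 | h1 <;> rcases h2 with h2 | h2 <;> rcases h3 with h3 | h3 <;>
      rw [h1, h2] at s1 <;> rw [h2, h3] at s2 <;> simp_all
  · rintro (rfl | rfl | rfl | rfl | rfl)
    · exact ⟨6, by norm_num, by rw [init _ (by norm_num) (by norm_num)]; decide⟩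
    · exact ⟨3, by norm_num, by rw [init _ (by norm_num) (by norm_num)]; decide⟩
    · exact ⟨4, by norm_num, by rw [init _ (by norm_num) (by norm_num)]; decide⟩
    · exact ⟨5, by norm_num, by rw [init _ (by norm_num) (by norm_num)]; decide⟩
    · exact ⟨14, by norm_num, by rw [init _ (by norm_num) (by norm_num)]; decide⟩

theorem theta_mem (h : IsGreedy a) {n : ℤ} (hn : 3 ≤ n) : theta a n ∈ ({0, 1} : Set ℤ) := by
  have h1 := h.jump_eq_zero_or_one (n := n + 2) (by omega)
  rw [h.theta_eq hn, Set.mem_insert_iff, Set.mem_singleton_iff]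
  omega

theorem epsFour_mem (h : IsGreedy a) {n : ℤ} (hn : 3 ≤ n) :
    epsFour a n ∈ ({-4, -3, -2} : Set ℤ) := by
  have h1 := h.jump_nonneg (n := n + 1) (by omega)
  have h2 := h.jump_nonneg (n := n + 2) (by omega)
  have h3 := h.jump_eq_zero_or_one (n := n + 3) (by omega)
  have h4 := h.jump_add_jump_succ (n := n + 1) (by omega)
  rw [add_assoc, show (1 : ℤ) + 1 = 2 by norm_num] at h4
  rw [h.epsFour_eq hn, Set.mem_insert_iff, Set.mem_insert_iff, Set.mem_singleton_iff]
  omega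

theorem theta_epsFour_init (h : IsGreedy a) {n : ℤ} (h3 : 3 ≤ n) (h14 : n ≤ 14) :
    theta a n = (if n ∈ ({11, 13} : Finset ℤ) then 0 else 1) ∧
    epsFour a n = (if n ∈ ({12, 14} : Finset ℤ) then -4
      else if n ∈ ({3, 10, 11, 13} : Finset ℤ) then -3 else -2) := by
  rw [h.theta_eq h3, h.epsFour_eq h3, h.jump_init (by omega) (by omega),
    h.jump_init (by omega) (by omega), h.jump_init (by omega) (by omega)]
  interval_cases n <;> decide

theorem tables (h : IsGreedy a) {m : ℤ} (hm : 3 ≤ m) :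
    (∀ d : Fin 5, theta a (5 * m + ((d : ℕ) : ℤ)) =
      thetaTable (pairU a (m - 1), pairU a m) d) ∧
    (∀ d : ℤ, d = 0 ∨ d = 2 → epsFour a (5 * m + d) = -2 - sigma a m - eps a m) ∧
    (∀ d : ℤ, d = 1 ∨ d = 3 → epsFour a (5 * m + d) = -2 - sigma a m - eta a m) ∧
    epsFour a (5 * m + 4) = epsFourTable (pairU a m, pairU a (m + 1)) := by
  have r1 := h.jump_five_mul_add_one hm
  have r2 := h.jump_five_mul_add_two hm
  have r3 := h.jump_five_mul_add_three hm
  have r4 := h.jump_five_mul_add_four hm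
  have r5 := h.jump_five_mul (m := m + 1) (by omega)
  have r6 := h.jump_five_mul_add_one (m := m + 1) (by omega)
  have r7 := h.jump_five_mul_add_two (m := m + 1) (by omega)
  rw [show 5 * (m + 1) = 5 * m + 5 by ring, add_sub_cancel_right] at r5
  rw [show 5 * (m + 1) + 1 = 5 * m + 6 by ring] at r6
  rw [show 5 * (m + 1) + 2 = 5 * m + 7 by ring, show m + 1 + 1 = m + 2 by ring] at r7
  have b0 := h.jump_eq_zero_or_one (n := m - 1) (by omega)
  have b1 := h.jump_eq_zero_or_one (n := m) (by omega)
  have b2 := h.jump_eq_zero_or_one (n := m + 1) (by omega)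
  have b3 := h.jump_eq_zero_or_one (n := m + 2) (by omega)
  have s1 := h.jump_add_jump_succ (n := m - 1) (by omega)
  have s2 := h.jump_add_jump_succ (n := m) (by omega)
  have s3 := h.jump_add_jump_succ (n := m + 1) (by omega)
  rw [sub_add_cancel] at s1
  rw [show m + 1 + 1 = m + 2 by ring] at s3
  have fourEq : ∀ d, 0 ≤ d → epsFour a (5 * m + d) = -2 - jump a (5 * m + (d + 1)) -
      jump a (5 * m + (d + 2)) - jump a (5 * m + (d + 3)) := fun d hd => by
    rw [h.epsFour_eq (by omega), add_assoc, add_assoc, add_assoc]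
  have thetaEq : ∀ d, 0 ≤ d → theta a (5 * m + d) = 1 - jump a (5 * m + (d + 2)) := fun d hd => by
    rw [h.theta_eq (by omega), add_assoc]
  have u0 : pairU a (m - 1) = (jump a (m - 1), jump a m) := by
    rw [pairU, h.eps_eq (by omega), h.eta_eq (by omega), sub_add_cancel]
  have u1 : pairU a m = (jump a m, jump a (m + 1)) := by
    rw [pairU, h.eps_eq (by omega), h.eta_eq (by omega)]
  have u2 : pairU a (m + 1) = (jump a (m + 1), jump a (m + 2)) := by
    rw [pairU, h.eps_eq (by omega), h.eta_eq (by omega), show m + 1 + 1 = m + 2 by ring]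
  rw [sigma, h.eps_eq (by omega), h.eta_eq (by omega), u0, u1, u2]
  refine ⟨fun d => ?_, ?_, ?_, ?_⟩
  · rw [thetaEq _ (by positivity)]
    rcases b0 with b0 | b0 <;> rcases b1 with b1 | b1 <;> rcases b2 with b2 | b2 <;>
      rw [b0, b1] at s1 <;> rw [b1, b2] at s2 <;> try omega
    all_goals
      rw [b0, b1, b2]
      fin_cases d <;> norm_num [thetaTable, r2, r3, r4, r5, r6, b1, b2]
  · rintro d (rfl | rfl) <;> rw [fourEq _ (by norm_num)] <;> norm_num [r1, r2, r3, r4, r5] <;> ring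
  · rintro d (rfl | rfl) <;> rw [fourEq _ (by norm_num)] <;> norm_num [r2, r3, r4, r5, r6] <;> ring
  · rw [fourEq _ (by norm_num)]
    norm_num only
    rw [r5, r6, r7]
    rcases b1 with b1 | b1 <;> rcases b2 with b2 | b2 <;> rcases b3 with b3 | b3 <;>
      rw [b1, b2] at s2 <;> rw [b2, b3] at s3 <;> try omega
    all_goals
      rw [b1, b2, b3]
      norm_num [epsFourTable]

end IsGreedy

theorem IsQuinaryPair.unique {e h e' h' : ℤ → ℤ} (q : IsQuinaryPair e h)
    (q' : IsQuinaryPair e' h') {n : ℤ} (hn : 1 ≤ n) : e n = e' n ∧ h n = h' n := by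
  have key : ∀ N : ℤ, 19 ≤ N → ∀ k, 1 ≤ k → k ≤ N → e k = e' k ∧ h k = h' k := by
    refine Int.leInduction (fun k h1 h2 => ?_) fun N hN ih k h1 h2 => ?_
    · exact ⟨by rw [q.e_init k h1 h2, q'.e_init k h1 h2], by rw [q.h_init k h1 h2, q'.h_init k h1 h2]⟩
    rcases h2.lt_or_eq with h2 | rfl
    · exact ih k h1 (by omega)
    obtain ⟨m, d, hd0, hd5, hm⟩ : ∃ m d : ℤ, 0 ≤ d ∧ d ≤ 4 ∧ N + 1 = 5 * m + d :=
      ⟨(N + 1) / 5, (N + 1) % 5, by omega, by omega, by omega⟩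
    have hm4 : 4 ≤ m := by omega
    have i1 := ih (m - 1) (by omega) (by omega)
    have i2 := ih m (by omega) (by omega)
    rw [hm]
    obtain rfl | rfl | rfl | rfl | rfl : d = 0 ∨ d = 1 ∨ d = 2 ∨ d = 3 ∨ d = 4 := by omega
    · rw [add_zero, q.e_zero m hm4, q'.e_zero m hm4, q.h_zero m hm4, q'.h_zero m hm4, i1.1, i2.1]
      exact ⟨rfl, rfl⟩
    · rwa [q.e_one m hm4, q'.e_one m hm4, q.h_one m hm4, q'.h_one m hm4]
    · rw [q.e_two m hm4, q'.e_two m hm4, q.h_two m hm4, q'.h_two m hm4]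
      exact i2.symm
    · rwa [q.e_three m hm4, q'.e_three m hm4, q.h_three m hm4, q'.h_three m hm4]
    · rw [q.e_four m hm4, q'.e_four m hm4, q.h_four m hm4, q'.h_four m hm4]
      exact i2.symm
  exact key (max n 19) (le_max_right _ _) n hn (le_max_left _ _)

end AlmostGolomb

/-! ### Automaticity and regularity -/

namespace AlmostGolomb

namespace IsGreedy

variable {a : ℤ → ℤ}

/-- The range of `j` is stable under the descent `5k+d ↦ k+r`. Its upper end leaves room for offsets
up to 3 beyond a kernel residue `j < 5^i`, as the correctors require. -/
theorem jump_kernel (h : IsGreedy a) (i : ℕ) : ∀ j : ℤ, -1 ≤ j → j ≤ 5 ^ i + 2 →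
    ∃ s : ℤ, s ∈ Set.Icc (-1) 3 ∧ ∀ n : ℤ, 5 ≤ n → jump a (5 ^ i * n + j) = jump a (n + s) := by
  induction i with
  | zero => exact fun j h1 h2 => ⟨j, ⟨h1, by simpa using h2⟩, fun n _ => by simp⟩
  | succ i ih =>
    intro j h1 h2
    obtain ⟨k, d, hd0, hd5, hj⟩ : ∃ k d : ℤ, 0 ≤ d ∧ d ≤ 4 ∧ j = 5 * k + d :=
      ⟨j / 5, j % 5, by omega, by omega, by omega⟩
    rw [pow_succ] at h2
    have hp : (1 : ℤ) ≤ 5 ^ i := one_le_pow₀ (by norm_num)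
    have arg : ∀ n : ℤ, 5 ^ (i + 1) * n + j = 5 * (5 ^ i * n + k) + d := fun n => by
      rw [hj, pow_succ]; ring
    have big : ∀ n : ℤ, 5 ≤ n → 4 ≤ 5 ^ i * n + k := fun n hn => by
      have : 1 * 5 ≤ 5 ^ i * n := mul_le_mul hp hn (by norm_num) (by omega)
      omega
    have step : ∃ r : ℤ, -1 ≤ k + r ∧ k + r ≤ 5 ^ i + 2 ∧
        ∀ m : ℤ, 4 ≤ m → jump a (5 * m + d) = jump a (m + r) := by
      obtain rfl | rfl | rfl | rfl | rfl : d = 0 ∨ d = 1 ∨ d = 2 ∨ d = 3 ∨ d = 4 := by omega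
      · exact ⟨-1, by omega, by omega, fun m hm => by
          rw [add_zero, h.jump_five_mul hm, sub_eq_add_neg]⟩
      · exact ⟨0, by omega, by omega, fun m hm => by
          rw [h.jump_five_mul_add_one (by omega), add_zero]⟩
      · exact ⟨1, by omega, by omega, fun m hm => h.jump_five_mul_add_two (by omega)⟩
      · exact ⟨0, by omega, by omega, fun m hm => by
          rw [h.jump_five_mul_add_three (by omega), add_zero]⟩
      · exact ⟨1, by omega, by omega, fun m hm => h.jump_five_mul_add_four (by omega)⟩
    obtain ⟨r, hr1, hr2, hr⟩ := step
    obtain ⟨s, hs, hs'⟩ := ih (k + r) hr1 hr2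
    refine ⟨s, hs, fun n hn => ?_⟩
    rw [arg, hr _ (big n hn), add_assoc, hs' n hn]

/-- A sequence that is eventually a function of a window of jumps is `5`-automatic. -/
theorem isAutomatic_of_jump (h : IsGreedy a) {α : Type*} (f : ℕ → α) (Φ : ℤ → ℤ → ℤ → ℤ → α)
    (hf : ∀ n : ℕ, 3 ≤ n →
      f n = Φ (jump a n) (jump a (n + 1)) (jump a (n + 2)) (jump a (n + 3))) :
    IsAutomatic 5 f := by
  have hrange : (Set.range f).Finite := by
    have hB : ({0, 1} : Set ℤ).Finite := by simp
    refine (((Set.finite_Iio 3).image f).union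
      (((hB.prod (hB.prod (hB.prod hB))).image fun p => Φ p.1 p.2.1 p.2.2.1 p.2.2.2))).subset ?_
    rintro _ ⟨n, rfl⟩
    rcases lt_or_ge n 3 with hn | hn
    · exact Or.inl ⟨n, hn, rfl⟩
    · refine Or.inr ⟨(jump a n, jump a (n + 1), jump a (n + 2), jump a (n + 3)), ?_, (hf n hn).symm⟩
      exact ⟨h.jump_eq_zero_or_one (by omega), h.jump_eq_zero_or_one (by omega),
        h.jump_eq_zero_or_one (by omega), h.jump_eq_zero_or_one (by omega)⟩
  refine ⟨hrange, ?_⟩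
  have : Finite (Set.range f) := hrange
  -- A kernel element is coded by its first five values and four bounded shifts, which leaves
  -- finitely many codes.
  let F : (Fin 5 → Set.range f) × (Fin 4 → Set.Icc (-1 : ℤ) 3) → ℕ → α := fun p n =>
    if hn : n < 5 then (p.1 ⟨n, hn⟩ : α)
    else Φ (jump a (n + p.2 0)) (jump a (n + p.2 1)) (jump a (n + p.2 2)) (jump a (n + p.2 3))
  refine (Set.finite_range F).subset ?_
  rintro g ⟨i, j, hj, rfl⟩
  have hj' : (j : ℤ) + 1 ≤ 5 ^ i := by exact_mod_cast hj
  have shift : ∀ c : Fin 4, ∃ s : Set.Icc (-1 : ℤ) 3, ∀ n : ℤ, 5 ≤ n →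
      jump a (5 ^ i * n + (j + (c : ℕ))) = jump a (n + s) := fun c => by
    obtain ⟨s, hs, hs'⟩ := h.jump_kernel i (j + (c : ℕ)) (by omega) (by omega)
    exact ⟨⟨s, hs⟩, hs'⟩
  choose s hs using shift
  refine ⟨(fun k => ⟨f (5 ^ i * k + j), Set.mem_range_self _⟩, s), ?_⟩
  funext n
  by_cases hn : n < 5
  · simp [F, hn]
  · have hp : 1 ≤ 5 ^ i := Nat.one_le_pow _ _ (by norm_num)
    have big : 1 * 5 ≤ 5 ^ i * n := Nat.mul_le_mul hp (by omega)
    have hn' : (5 : ℤ) ≤ n := by omega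
    simp only [F, dif_neg hn]
    rw [hf _ (by omega), ← hs 0 n hn', ← hs 1 n hn', ← hs 2 n hn', ← hs 3 n hn']
    push_cast
    simp [add_assoc]

theorem isAutomatic_pairU (h : IsGreedy a) : IsAutomatic 5 fun n : ℕ => pairU a n :=
  h.isAutomatic_of_jump _ (fun x y _ _ => (x, y)) fun n hn => by
    rw [pairU, h.eps_eq (by omega), h.eta_eq (by omega)]

theorem isAutomatic_theta (h : IsGreedy a) : IsAutomatic 5 fun n : ℕ => theta a n :=
  h.isAutomatic_of_jump _ (fun _ _ z _ => 1 - z) fun n hn => h.theta_eq (by omega)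

theorem isAutomatic_epsFour (h : IsGreedy a) : IsAutomatic 5 fun n : ℕ => epsFour a n :=
  h.isAutomatic_of_jump _ (fun _ y z w => -2 - y - z - w) fun n hn => h.epsFour_eq (by omega)

theorem apply_five_mul_add (h : IsGreedy a) {d : ℤ} (h0 : 0 ≤ d) (h4 : d ≤ 4) :
    ∃ r c : ℤ, 0 ≤ r ∧ r ≤ 2 ∧ ∀ m, 3 ≤ m → a (5 * m + d) = windowSum 5 a (m + r) + c := by
  obtain rfl | rfl | rfl | rfl | rfl : d = 0 ∨ d = 1 ∨ d = 2 ∨ d = 3 ∨ d = 4 := by omega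
  · refine ⟨1, 0, by norm_num, by norm_num, fun m hm => ?_⟩
    rw [add_zero, (h.denests hm).zero, windowSum_add_one]; ring
  · refine ⟨0, 3, by norm_num, by norm_num, fun m hm => ?_⟩
    rw [(h.denests hm).one, add_zero]
  · refine ⟨1, 1, by norm_num, by norm_num, fun m hm => ?_⟩
    rw [(h.denests hm).two, windowSum_add_one]; ring
  · refine ⟨2, -1, by norm_num, by norm_num, fun m hm => ?_⟩
    rw [(h.denests hm).three, windowSum_add_two]; ring
  · refine ⟨1, 2, by norm_num, by norm_num, fun m hm => ?_⟩
    rw [(h.denests hm).four, windowSum_add_one]; ring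

/-- The constant `1` and the shifts of `a` that span its `5`-kernel up to finitely many terms. -/
def shifts (a : ℤ → ℤ) : Set (ℕ → ℤ) :=
  insert 1 ((fun s : ℤ => fun n : ℕ => a (n + s)) '' Set.Icc (-5) 3)

/-- Each descent replaces `a (5m+d)` by five shifted terms plus a constant. The lower end `-5` is
stable: `j ≥ -5` gives `k ≥ -1`, and the window reaches back 4. -/
theorem exists_mem_span_shifts (h : IsGreedy a) (i : ℕ) : ∀ j : ℤ, -5 ≤ j → j ≤ 5 ^ i + 2 →
    ∃ g ∈ Submodule.span ℤ (shifts a), ∀ n : ℕ, 5 ≤ n → a (5 ^ i * n + j) = g n := by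
  induction i with
  | zero =>
    exact fun j h1 h2 => ⟨fun n => a (n + j), Submodule.subset_span
      (Or.inr ⟨j, ⟨h1, by simpa using h2⟩, rfl⟩), fun n _ => by simp⟩
  | succ i ih =>
    intro j h1 h2
    obtain ⟨k, d, hd0, hd4, hj⟩ : ∃ k d : ℤ, 0 ≤ d ∧ d ≤ 4 ∧ j = 5 * k + d :=
      ⟨j / 5, j % 5, by omega, by omega, by omega⟩
    rw [pow_succ] at h2
    have hp : (1 : ℤ) ≤ 5 ^ i := one_le_pow₀ (by norm_num)
    obtain ⟨r, c, hr0, hr2, hr⟩ := h.apply_five_mul_add hd0 hd4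
    obtain ⟨g0, m0, e0⟩ := ih (k + r) (by omega) (by omega)
    obtain ⟨g1, m1, e1⟩ := ih (k + r - 1) (by omega) (by omega)
    obtain ⟨g2, m2, e2⟩ := ih (k + r - 2) (by omega) (by omega)
    obtain ⟨g3, m3, e3⟩ := ih (k + r - 3) (by omega) (by omega)
    obtain ⟨g4, m4, e4⟩ := ih (k + r - 4) (by omega) (by omega)
    have one_mem : (1 : ℕ → ℤ) ∈ Submodule.span ℤ (shifts a) :=
      Submodule.subset_span (Set.mem_insert _ _)
    refine ⟨g0 + g1 + g2 + g3 + g4 + c • 1, ?_, fun n hn => ?_⟩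
    · exact add_mem (add_mem (add_mem (add_mem (add_mem m0 m1) m2) m3) m4)
        (Submodule.smul_mem _ _ one_mem)
    · have big : (1 : ℤ) * 5 ≤ 5 ^ i * n := mul_le_mul hp (by omega) (by norm_num) (by omega)
      rw [show (5 : ℤ) ^ (i + 1) * n + j = 5 * (5 ^ i * n + k) + d by rw [hj, pow_succ]; ring,
        hr _ (by omega), windowSum_five]
      simp only [Pi.add_apply, Pi.smul_apply, Pi.one_apply, smul_eq_mul, mul_one]
      rw [← e0 n hn, ← e1 n hn, ← e2 n hn, ← e3 n hn, ← e4 n hn]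
      simp only [add_assoc, add_sub_assoc]

theorem isRegular (h : IsGreedy a) : IsRegular 5 fun n : ℕ => a n := by
  -- The unit sequences correct the first five terms. The kernel then spans a submodule of a
  -- finitely generated `ℤ`-module, which is Noetherian.
  set S : Set (ℕ → ℤ) := shifts a ∪ Set.range fun k : Fin 5 => Pi.single (k : ℕ) (1 : ℤ) with hS
  have hfin : S.Finite :=
    (((Set.finite_Icc _ _).image _).insert _).union (Set.finite_range _)
  have : IsNoetherian ℤ (Submodule.span ℤ S) :=
    isNoetherian_of_fg_of_noetherian _ (Submodule.fg_span hfin)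
  refine isNoetherian_submodule.1 this _ (Submodule.span_le.2 ?_)
  rintro f ⟨i, j, hj, rfl⟩
  have hj' : (j : ℤ) + 1 ≤ 5 ^ i := by exact_mod_cast hj
  obtain ⟨g, hg, e⟩ := h.exists_mem_span_shifts i j (by omega) (by omega)
  have split : (fun n : ℕ => a ((5 ^ i * n + j : ℕ) : ℤ)) = g +
      ∑ k : Fin 5, (a ((5 ^ i * (k : ℕ) + j : ℕ) : ℤ) - g k) • Pi.single (k : ℕ) (1 : ℤ) := by
    funext n
    simp only [Pi.add_apply, Finset.sum_apply, Pi.smul_apply, smul_eq_mul]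
    by_cases hn : n < 5
    · rw [Finset.sum_eq_single (⟨n, hn⟩ : Fin 5)]
      · simp
      · intro b _ hb
        rw [Pi.single_eq_of_ne (fun hc => hb (Fin.ext hc.symm)), mul_zero]
      · simp
    · rw [Finset.sum_eq_zero fun k _ => by
        rw [Pi.single_eq_of_ne (by omega), mul_zero], add_zero, ← e n (by omega)]
      push_cast
      rfl
  rw [SetLike.mem_coe, split]
  refine add_mem (Submodule.span_mono Set.subset_union_left hg) (sum_mem fun k _ => ?_)
  exact Submodule.smul_mem _ _ (Submodule.subset_span (Or.inr ⟨k, rfl⟩))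

end IsGreedy

end AlmostGolomb

theorem mainTheorem6 :
    (∃! a : ℤ → ℤ, AlmostGolomb.IsAlmostGolomb 5 a) ∧
    ∀ a : ℤ → ℤ, AlmostGolomb.IsAlmostGolomb 5 a →
      -- the five denesting formulas
      (∀ n : ℤ, 3 ≤ n →
        a (5 * n) = AlmostGolomb.windowSum 5 a n + 2 + AlmostGolomb.eps a n ∧
        a (5 * n + 1) = AlmostGolomb.windowSum 5 a (n + 1) + 1 - AlmostGolomb.eps a n ∧
        a (5 * n + 2) = AlmostGolomb.windowSum 5 a (n + 2) - 1 - AlmostGolomb.eta a n ∧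
        a (5 * n + 3) = AlmostGolomb.windowSum 5 a (n + 3) - 4 + AlmostGolomb.theta a n ∧
        a (5 * n + 4) = AlmostGolomb.windowSum 5 a (n + 4) - 2 + AlmostGolomb.epsFour a n) ∧
      -- the pair is binary and disjoint
      (∀ n : ℤ, 1 ≤ n →
        (AlmostGolomb.eps a n = 0 ∨ AlmostGolomb.eps a n = 1) ∧
        (AlmostGolomb.eta a n = 0 ∨ AlmostGolomb.eta a n = 1) ∧
        AlmostGolomb.eps a n * AlmostGolomb.eta a n = 0) ∧
      -- it satisfies the recurrences with the initial values, and is determined by them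
      AlmostGolomb.IsQuinaryPair (AlmostGolomb.eps a) (AlmostGolomb.eta a) ∧
      (∀ e h : ℤ → ℤ, AlmostGolomb.IsQuinaryPair e h →
        ∀ n : ℤ, 1 ≤ n → e n = AlmostGolomb.eps a n ∧ h n = AlmostGolomb.eta a n) ∧
      -- the transitions of the pair at consecutive indices
      {p | ∃ m : ℤ, 3 ≤ m ∧ p = (AlmostGolomb.pairU a (m - 1), AlmostGolomb.pairU a m)} =
        AlmostGolomb.transitions ∧
      -- ranges, initial values and tables of the two further correctors
      (∀ n : ℤ, 3 ≤ n →
        AlmostGolomb.theta a n ∈ ({0, 1} : Set ℤ) ∧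
        AlmostGolomb.epsFour a n ∈ ({-4, -3, -2} : Set ℤ)) ∧
      (∀ n : ℤ, 3 ≤ n → n ≤ 14 →
        AlmostGolomb.theta a n = (if n ∈ ({11, 13} : Finset ℤ) then 0 else 1) ∧
        AlmostGolomb.epsFour a n =
          (if n ∈ ({12, 14} : Finset ℤ) then -4
            else if n ∈ ({3, 10, 11, 13} : Finset ℤ) then -3 else -2)) ∧
      (∀ m : ℤ, 3 ≤ m →
        (∀ d : Fin 5, AlmostGolomb.theta a (5 * m + ((d : ℕ) : ℤ)) =
          AlmostGolomb.thetaTable (AlmostGolomb.pairU a (m - 1), AlmostGolomb.pairU a m) d) ∧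
        (∀ d : ℤ, d = 0 ∨ d = 2 → AlmostGolomb.epsFour a (5 * m + d) =
          -2 - AlmostGolomb.sigma a m - AlmostGolomb.eps a m) ∧
        (∀ d : ℤ, d = 1 ∨ d = 3 → AlmostGolomb.epsFour a (5 * m + d) =
          -2 - AlmostGolomb.sigma a m - AlmostGolomb.eta a m) ∧
        AlmostGolomb.epsFour a (5 * m + 4) =
          AlmostGolomb.epsFourTable (AlmostGolomb.pairU a m, AlmostGolomb.pairU a (m + 1))) ∧
      -- automaticity of the correctors and regularity of the sequence
      AlmostGolomb.IsAutomatic 5 (fun n : ℕ => AlmostGolomb.pairU a (n : ℤ)) ∧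
      AlmostGolomb.IsAutomatic 5 (fun n : ℕ => AlmostGolomb.theta a (n : ℤ)) ∧
      AlmostGolomb.IsAutomatic 5 (fun n : ℕ => AlmostGolomb.epsFour a (n : ℤ)) ∧
      AlmostGolomb.IsRegular 5 (fun n : ℕ => a (n : ℤ)) := by
  obtain ⟨g, hg⟩ := AlmostGolomb.exists_isGreedy
  refine ⟨⟨g, hg.isAlmostGolomb, fun b hb => hb.unique hg.isAlmostGolomb⟩, fun a ha => ?_⟩
  have h : AlmostGolomb.IsGreedy a := by rwa [ha.unique hg.isAlmostGolomb]
  exact ⟨fun _ => h.denesting, fun _ => h.pair_binary, h.isQuinaryPair,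
    fun _ _ q _ hn => q.unique h.isQuinaryPair hn, h.transitions_eq,
    fun _ hn => ⟨h.theta_mem hn, h.epsFour_mem hn⟩, fun _ => h.theta_epsFour_init,
    fun _ => h.tables, h.isAutomatic_pairU, h.isAutomatic_theta, h.isAutomatic_epsFour,
    h.isRegular⟩
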